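/- Let $R$ be an associative ring with identity; modules are left $R$-modules and complexes are cochain complexes indexed by $\mathbb{Z}$. A short exact sequence of modules is pure exact if it stays exact under $M\otimes_R-$ for every right $R$-module $M$; its first map is then called a pure monomorphism and its second map a pure epimorphism. A complex $X$ is pure exact if for every $n$ the differentials $d^{n-1}$ and $d^n$ each factor as a pure epimorphism followed by a pure monomorphism and the sequence $0\to\operatorname{Ker}d^n\to X^n\to\operatorname{Coker}d^{n-1}\to 0$ is pure exact. A module is pure injective if it is injective with respect to pure exact sequences. A cochain map is a pure quasi-isomorphism if its mapping cone is pure exact. For complexes $E, I$, $\operatorname{Hom}_R(E,I)$ denotes the total complex of $\mathbb{Z}$-modules with $\prod_{i\in\mathbb{Z}}\operatorname{Hom}_R(E^i,I^{i+n})$ in degree $n$ and differential $\varphi\mapsto d_I\circ\varphi-(-1)^n\varphi\circ d_E$. Theorem 5.2. Let $X$ be a bounded above complex of $R$-modules, that is, there is $b\in\mathbb{Z}$ with $X^i=0$ for all $i>b$. Then $X$ has a pure injective resolution: there exist a complex $I$ all of whose terms $I^n$ are pure injective $R$-modules and a pure quasi-isomorphism $f:X\to I$, such that for every pure exact complex $E$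 of $R$-modules the complex $\operatorname{Hom}_R(E,I)$ of $\mathbb{Z}$-modules is pure exact. -/

import Mathlib

open CategoryTheory TensorProduct

universe u v

namespace PureHomology

section Tensor

variable (R : Type u) [Ring R]

/-- The relations `(m r) ⊗ n = m ⊗ (r n)` inside `M ⊗_ℤ N`, for a right `R`-module `M`
(a module over `Rᵐᵒᵖ`) and a left `R`-module `N`. -/
def balancedRel (M : Type*) [AddCommGroup M] [Module Rᵐᵒᵖ M]
    (N : Type*) [AddCommGroup N] [Module R N] : Submodule ℤ (M ⊗[ℤ] N) :=
  Submodule.span ℤ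
    {t | ∃ (m : M) (r : R) (n : N), t = (MulOpposite.op r • m) ⊗ₜ[ℤ] n - m ⊗ₜ[ℤ] (r • n)}

/-- The tensor product `M ⊗_R N` (an abelian group) of a right and a left module over a ring
that need not be commutative. -/
abbrev BalancedTensor (M : Type*) [AddCommGroup M] [Module Rᵐᵒᵖ M]
    (N : Type*) [AddCommGroup N] [Module R N] :=
  (M ⊗[ℤ] N) ⧸ balancedRel R M N

variable {R}

theorem balancedRel_le_comap (M : Type*) [AddCommGroup M] [Module Rᵐᵒᵖ M]
    {A B : Type*} [AddCommGroup A] [Module R A] [AddCommGroup B] [Module R B] (f : A →ₗ[R] B) :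
    balancedRel R M A ≤
      (balancedRel R M B).comap (LinearMap.lTensor M f.toAddMonoidHom.toIntLinearMap) := by
  refine Submodule.span_le.2 ?_
  rintro _ ⟨m, r, a, rfl⟩
  refine Submodule.subset_span ⟨m, r, f a, ?_⟩
  simp

/-- The map `M ⊗_R f : M ⊗_R A → M ⊗_R B`. -/
def balancedMap (M : Type*) [AddCommGroup M] [Module Rᵐᵒᵖ M]
    {A B : Type*} [AddCommGroup A] [Module R A] [AddCommGroup B] [Module R B] (f : A →ₗ[R] B) :
    BalancedTensor R M A →ₗ[ℤ] BalancedTensor R M B :=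
  Submodule.mapQ _ _ (LinearMap.lTensor M f.toAddMonoidHom.toIntLinearMap)
    (balancedRel_le_comap M f)

end Tensor

section Pure

variable {R : Type u} [Ring R]

/-- The sequence `0 → A → B → C → 0` of left `R`-modules is exact and stays exact under
`M ⊗_R -` for every right `R`-module `M`. -/
structure IsPureShortExact {A B C : Type v} [AddCommGroup A] [Module R A]
    [AddCommGroup B] [Module R B] [AddCommGroup C] [Module R C]
    (f : A →ₗ[R] B) (g : B →ₗ[R] C) : Prop where
  injective : Function.Injective f
  exact : Function.Exact f g
  surjective : Function.Surjective g
  tensor : ∀ (M : Type (max u v)) [AddCommGroup M] [Module Rᵐᵒᵖ M],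
    Function.Injective (balancedMap M f) ∧
      Function.Exact (balancedMap M f) (balancedMap M g) ∧
      Function.Surjective (balancedMap M g)

/-- `f` is the monomorphism of a pure exact sequence. -/
def IsPureMono {A B : ModuleCat.{v} R} (f : A ⟶ B) : Prop :=
  ∃ (C : ModuleCat.{v} R) (g : B ⟶ C), IsPureShortExact f.hom g.hom

/-- `g` is the epimorphism of a pure exact sequence. -/
def IsPureEpi {B C : ModuleCat.{v} R} (g : B ⟶ C) : Prop :=
  ∃ (A : ModuleCat.{v} R) (f : A ⟶ B), IsPureShortExact f.hom g.hom

/-- `d` decomposes as a pure epimorphism followed by a pure monomorphism. -/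
def IsPureDecomposable {A B : ModuleCat.{v} R} (d : A ⟶ B) : Prop :=
  ∃ (D : ModuleCat.{v} R) (p : A ⟶ D) (i : D ⟶ B), IsPureEpi p ∧ IsPureMono i ∧ p ≫ i = d

/-- Pure exactness of a cochain complex at the spot `n`: the differentials into and out of `X^n`
decompose in the pure exact structure, and `0 → Ker d^n → X^n → Coker d^{n-1} → 0` is
pure exact. -/
structure IsPureExactAt (X : CochainComplex (ModuleCat.{v} R) ℤ) (n : ℤ) : Prop where
  decomposable_prev : IsPureDecomposable (X.d (n - 1) n)
  decomposable_next : IsPureDecomposable (X.d n (n + 1))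
  ses : IsPureShortExact (LinearMap.ker (X.d n (n + 1)).hom).subtype
    (LinearMap.range (X.d (n - 1) n).hom).mkQ

/-- A pure exact complex. -/
def IsPureExact (X : CochainComplex (ModuleCat.{v} R) ℤ) : Prop :=
  ∀ n : ℤ, IsPureExactAt X n

/-- A pure injective module: one that is injective with respect to pure exact sequences. -/
def IsPureInjective (I : ModuleCat.{v} R) : Prop :=
  ∀ ⦃A B : ModuleCat.{v} R⦄ (f : A ⟶ B), IsPureMono f →
    ∀ h : A ⟶ I, ∃ k : B ⟶ I, f ≫ k = h

/-- A cochain map whose mapping cone is pure exact. -/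
def IsPureQuasiIso {X Y : CochainComplex (ModuleCat.{v} R) ℤ} (f : X ⟶ Y) : Prop :=
  IsPureExact (CochainComplex.mappingCone f)

/-- An abelian group as a `ℤ`-module. -/
def toIntModule : AddCommGrpCat.{v} ⥤ ModuleCat.{v} ℤ where
  obj A := ModuleCat.of ℤ A
  map f := ModuleCat.ofHom f.hom.toIntLinearMap

instance : toIntModule.{v}.Additive where

/-- The total complex `Hom_R(X, Y)`, a cochain complex of `ℤ`-modules: in degree `n` it is
`∏ i, Hom_R(X^i, Y^{i+n})`, with differential `d φ = d_Y ∘ φ - (-1)^n φ ∘ d_X`. -/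
noncomputable def homComplex (X Y : CochainComplex (ModuleCat.{v} R) ℤ) :
    CochainComplex (ModuleCat.{v} ℤ) ℤ :=
  (toIntModule.mapHomologicalComplex _).obj (CochainComplex.HomComplex X Y)

/-- `f : X ⟶ I` is a pure injective resolution of `X`: a pure quasi-isomorphism to a complex of
pure injective modules such that `Hom_R(-, I)` preserves pure exact complexes. -/
structure IsPureInjectiveResolution {X I : CochainComplex (ModuleCat.{v} R) ℤ}
    (f : X ⟶ I) : Prop where
  quasiIso : IsPureQuasiIso f
  pureInjective : ∀ n : ℤ, IsPureInjective (I.X n)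
  hom_pureExact : ∀ E : CochainComplex (ModuleCat.{v} R) ℤ,
    IsPureExact E → IsPureExact (homComplex E I)

end Pure

end PureHomology

/-!
The resolution comes from an Adams tower `⋯ ⟶ C₂ ⟶ C₁ ⟶ C₀ = X`: the complex `C_{l+1}` is the
mapping cocone of the canonical map from `C_l` to the complex `J_l`, with zero differential, of
double character modules of the cokernels of the differentials of `C_l`. The embedding of a module
in its double character module is pure, and so are products of such embeddings. Hence
`∏ C_l ⟶ ∏ J_l` is injective on homology after applying `M ⊗_R -`, for every `M`, and the shift of
the tower vanishes there. So `1 - shift`, which is split surjective in each degree, is a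
quasi-isomorphism after tensoring, and its kernel `lim C_l` is pure exact.

Let `F` be the kernel of the degreewise split map `lim C_l ⟶ X` and `I = F⟦1⟧`. The cone of the
connecting map `X ⟶ I` is `(lim C_l)⟦1⟧`, and `I` is in each degree the product of the `J_l`,
which are pure injective. For `E` pure exact, contractions of the complexes `Hom(E, J_l^q)` assemble
to a homotopy on `Hom(E, I)`. Since the `J_l` have zero differential, it is a null-homotopy of some
`1 - N` with `N` strictly triangular with respect to `l`. As `1 - N` is invertible, `Hom(E, I)` is
contractible.
-/

namespace PureHomology

/-! ### Tensor products over a noncommutative ring -/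

section BalancedTensor

variable {R : Type u} [Ring R] {M : Type*} [AddCommGroup M] [Module Rᵐᵒᵖ M]
  {A B C : Type*} [AddCommGroup A] [Module R A] [AddCommGroup B] [Module R B]
  [AddCommGroup C] [Module R C]

variable (R) in
/-- The pure tensors `m ⊗ a` in `M ⊗_R A`, as a biadditive map. -/
def pureTensor : M →+ A →+ BalancedTensor R M A :=
  AddMonoidHom.mk' (fun m => AddMonoidHom.mk' (fun a => Submodule.Quotient.mk (m ⊗ₜ[ℤ] a))
      (fun a b => by rw [TensorProduct.tmul_add, Submodule.Quotient.mk_add]))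
    (fun m n => AddMonoidHom.ext fun a => by
      simp only [AddMonoidHom.mk'_apply, AddMonoidHom.add_apply, TensorProduct.add_tmul,
        Submodule.Quotient.mk_add])

theorem pureTensor_smul (m : M) (r : R) (a : A) :
    pureTensor R m (r • a) = pureTensor R (MulOpposite.op r • m) a :=
  ((Submodule.Quotient.eq (balancedRel R M A)).2 (Submodule.subset_span ⟨m, r, a, rfl⟩)).symm

@[simp] theorem balancedMap_pureTensor (f : A →ₗ[R] B) (m : M) (a : A) :
    balancedMap M f (pureTensor R m a) = pureTensor R m (f a) :=
  rfl

theorem BalancedTensor.induction {p : BalancedTensor R M A → Prop} (zero : p 0)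
    (pure : ∀ m a, p (pureTensor R m a)) (add : ∀ x y, p x → p y → p (x + y))
    (t : BalancedTensor R M A) : p t := by
  obtain ⟨s, rfl⟩ := Submodule.Quotient.mk_surjective _ t
  induction s using TensorProduct.induction_on with
  | zero => exact zero
  | tmul m a => exact pure m a
  | add x y hx hy => exact add _ _ hx hy

theorem BalancedTensor.hom_ext {P : Type*} [AddCommGroup P] {f g : BalancedTensor R M A →ₗ[ℤ] P}
    (h : ∀ m a, f (pureTensor R m a) = g (pureTensor R m a)) : f = g := by
  refine LinearMap.ext fun t => ?_
  induction t using BalancedTensor.induction with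
  | zero => rw [map_zero, map_zero]
  | pure m a => exact h m a
  | add x y hx hy => rw [map_add, map_add, hx, hy]

theorem balancedMap_id : balancedMap M (LinearMap.id : A →ₗ[R] A) = LinearMap.id :=
  BalancedTensor.hom_ext fun _ _ => rfl

theorem balancedMap_comp (g : B →ₗ[R] C) (f : A →ₗ[R] B) :
    balancedMap M (g ∘ₗ f) = balancedMap M g ∘ₗ balancedMap M f :=
  BalancedTensor.hom_ext fun _ _ => rfl

theorem balancedMap_add (f g : A →ₗ[R] B) :
    balancedMap M (f + g) = balancedMap M f + balancedMap M g :=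
  BalancedTensor.hom_ext fun m _ => map_add (pureTensor R m) _ _

theorem balancedMap_zero : balancedMap M (0 : A →ₗ[R] B) = 0 :=
  BalancedTensor.hom_ext fun m _ => map_zero (pureTensor R m)

/-- The map out of `M ⊗_R A` given by a balanced biadditive map. -/
def balancedLift {P : Type*} [AddCommGroup P] (β : M →+ A →+ P)
    (hβ : ∀ (m : M) (r : R) (a : A), β m (r • a) = β (MulOpposite.op r • m) a) :
    BalancedTensor R M A →ₗ[ℤ] P :=
  Submodule.liftQ _
    (TensorProduct.lift
      (LinearMap.mk₂ ℤ (fun m a => β m a) (by simp) (by simp) (by simp) (by simp)))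
    (by
      refine Submodule.span_le.2 ?_
      rintro _ ⟨m, r, a, rfl⟩
      exact (map_sub _ _ _).trans (sub_eq_zero.2 (hβ m r a).symm))

theorem balancedMap_surjective {f : A →ₗ[R] B} (hf : Function.Surjective f) :
    Function.Surjective (balancedMap M f) := by
  rw [← LinearMap.range_eq_top, eq_top_iff]
  rintro t -
  induction t using BalancedTensor.induction with
  | zero => exact zero_mem _
  | pure m b =>
    obtain ⟨a, rfl⟩ := hf b
    exact ⟨pureTensor R m a, rfl⟩
  | add x y hx hy => exact add_mem hx hy

theorem pureTensor_mem_range {f : A →ₗ[R] B} {g : B →ₗ[R] C} (hfg : Function.Exact f g) (m : M)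
    {b : B} (hb : g b = 0) : pureTensor R m b ∈ LinearMap.range (balancedMap M f) := by
  obtain ⟨a, rfl⟩ := (hfg b).1 hb
  exact ⟨pureTensor R m a, rfl⟩

theorem balancedMap_exact {f : A →ₗ[R] B} {g : B →ₗ[R] C} (hfg : Function.Exact f g)
    (hg : Function.Surjective g) : Function.Exact (balancedMap M f) (balancedMap M g) := by
  let q := (LinearMap.range (balancedMap M f)).mkQ
  have hq (m : M) {b b' : B} (h : g b = g b') : q (pureTensor R m b) = q (pureTensor R m b') := by
    refine (Submodule.Quotient.eq _).2 ?_
    rw [← map_sub]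
    exact pureTensor_mem_range hfg m (by rw [map_sub, h, sub_self])
  choose σ hσ using hg
  let β : M →+ C →+ _ := AddMonoidHom.mk'
    (fun m => AddMonoidHom.mk' (fun c => q (pureTensor R m (σ c))) fun c c' => by
      rw [← map_add, ← map_add]
      exact hq m (by simp only [hσ, map_add]))
    (fun m m' => AddMonoidHom.ext fun c => by
      simp only [AddMonoidHom.mk'_apply, AddMonoidHom.add_apply, map_add])
  -- `s` inverts the map `(M ⊗ B) / (M ⊗ A) → M ⊗ C` induced by `g`.
  let s : BalancedTensor R M C →ₗ[ℤ] _ := balancedLift β fun m r c => by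
    simp only [β, AddMonoidHom.mk'_apply, ← pureTensor_smul]
    exact hq m (by simp only [hσ, map_smul])
  have hs : s ∘ₗ balancedMap M g = q := BalancedTensor.hom_ext fun m b => hq m (hσ (g b))
  refine LinearMap.exact_of_comp_of_mem_range ?_ fun t ht => ?_
  · rw [← balancedMap_comp, hfg.linearMap_comp_eq_zero, balancedMap_zero]
  · rw [← Submodule.Quotient.mk_eq_zero, ← Submodule.mkQ_apply, ← LinearMap.congr_fun hs t,
      LinearMap.comp_apply, ht, map_zero]

variable (R M) in
/-- The functor `M ⊗_R -` on left modules, with values in abelian groups. -/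
def tensorFunctor : ModuleCat.{v} R ⥤ ModuleCat ℤ where
  obj A := ModuleCat.of ℤ (BalancedTensor R M A)
  map f := ModuleCat.ofHom (balancedMap M f.hom)
  map_id _ := ModuleCat.hom_ext balancedMap_id
  map_comp f g := ModuleCat.hom_ext (balancedMap_comp g.hom f.hom)

instance : (tensorFunctor R M).Additive where
  map_add {_ _ f g} := ModuleCat.hom_ext (balancedMap_add f.hom g.hom)

end BalancedTensor

/-! ### Purity and systems of linear equations -/

section LinearSystems

variable {R : Type u} [Ring R] {M : Type*} [AddCommGroup M] [Module Rᵐᵒᵖ M]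
  {A B : Type*} [AddCommGroup A] [Module R A] [AddCommGroup B] [Module R B]

variable (R M A) in
/-- The subgroup of formal sums `∑ m ⊗ a` generated by the `∑ m, m ⊗ ρ m • b` with
`∑ m, m * ρ m = 0`; it is the kernel of the presentation of `M ⊗_R A` by formal sums. -/
noncomputable def formalRelations : Submodule ℤ (M →₀ A) :=
  Submodule.span ℤ {w | ∃ ρ : M →₀ Rᵐᵒᵖ, Finsupp.linearCombination Rᵐᵒᵖ id ρ = 0 ∧
    ∃ b : A, ρ.mapRange (fun r => r.unop • b) (zero_smul R b) = w}

theorem mkQ_formalRelations_eq {x y : M →₀ A} (ρ : M →₀ Rᵐᵒᵖ) (b : A)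
    (hρ : Finsupp.linearCombination Rᵐᵒᵖ id ρ = 0) (hxy : ∀ m, x m - y m = (ρ m).unop • b) :
    (formalRelations R M A).mkQ x = (formalRelations R M A).mkQ y :=
  (Submodule.Quotient.eq _).2 (Submodule.subset_span
    ⟨ρ, hρ, b, Finsupp.ext fun m => (hxy m).symm⟩)

variable (R M A) in
/-- Tensors as formal sums modulo relations. -/
noncomputable def toFormalSum : BalancedTensor R M A →ₗ[ℤ] (M →₀ A) ⧸ formalRelations R M A :=
  balancedLift
    (AddMonoidHom.mk' (fun m => (formalRelations R M A).mkQ.toAddMonoidHom.comp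
        (Finsupp.singleAddHom m)) fun m n => AddMonoidHom.ext fun a => by
      classical
      refine (mkQ_formalRelations_eq (.single (m + n) 1 - (.single m 1 + .single n 1)) a
        (by simp) fun x => ?_).trans (map_add _ _ _)
      simp [Finsupp.single_apply, sub_smul, add_smul, apply_ite MulOpposite.unop, ite_smul])
    (fun m r a => by
      classical
      refine mkQ_formalRelations_eq
        (.single m (.op r) - .single (MulOpposite.op r • m) 1) a (by simp) fun x => ?_
      simp [Finsupp.single_apply, sub_smul, apply_ite MulOpposite.unop, ite_smul])

theorem BalancedTensor.exists_finsupp_sum_eq (t : BalancedTensor R M A) :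
    ∃ w : M →₀ A, (w.sum fun m a => pureTensor R m a) = t := by
  induction t using BalancedTensor.induction with
  | zero => exact ⟨0, Finsupp.sum_zero_index⟩
  | pure m a => exact ⟨.single m a, Finsupp.sum_single_index (map_zero _)⟩
  | add x y hx hy =>
    classical
    obtain ⟨x, rfl⟩ := hx
    obtain ⟨y, rfl⟩ := hy
    exact ⟨x + y, Finsupp.sum_add_index' (fun _ => map_zero _) fun _ => map_add _⟩

theorem exists_relations_of_sum_eq_zero {w : M →₀ A}
    (hw : (w.sum fun m a => pureTensor R m a) = 0) :
    ∃ (p : ℕ) (ρ : Fin p → M →₀ Rᵐᵒᵖ) (b : Fin p → A),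
      (∀ j, Finsupp.linearCombination Rᵐᵒᵖ id (ρ j) = 0) ∧
        ∀ m, w m = ∑ j, (ρ j m).unop • b j := by
  have hmem : w ∈ formalRelations R M A := by
    rw [← Submodule.Quotient.mk_eq_zero, ← map_zero (toFormalSum R M A), ← hw, Finsupp.sum,
      map_sum]
    conv_lhs => rw [← Submodule.mkQ_apply, ← Finsupp.sum_single w, Finsupp.sum, map_sum]
    rfl
  obtain ⟨p, c, g, rfl⟩ := Submodule.mem_span_set'.1 hmem
  choose ρ hρ b hb using fun j => (g j).2
  refine ⟨p, ρ, fun j => c j • b j, hρ, fun m => ?_⟩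
  rw [Finsupp.finsetSum_apply]
  refine Finset.sum_congr rfl fun j _ => ?_
  rw [Finsupp.smul_apply, ← hb j, Finsupp.mapRange_apply, smul_comm]

/-- Every finite system of linear equations with right-hand sides in `A` that is solvable in `B`
is solvable in `A`. This is the equational form of purity of a monomorphism; unlike injectivity
after tensoring, it visibly passes to products. -/
def ReflectsLinearSystems (f : A →ₗ[R] B) : Prop :=
  ∀ ⦃q p : ℕ⦄ (r : Fin q → Fin p → R) (a : Fin q → A) (b : Fin p → B),
    (∀ l, f (a l) = ∑ i, r l i • b i) → ∃ x : Fin p → A, ∀ l, a l = ∑ i, r l i • x i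

theorem ReflectsLinearSystems.exists_solution {f : A →ₗ[R] B} (hf : ReflectsLinearSystems f)
    {ι : Type*} [Finite ι] {p : ℕ} (r : ι → Fin p → R) (a : ι → A) (b : Fin p → B)
    (h : ∀ l, f (a l) = ∑ i, r l i • b i) : ∃ x : Fin p → A, ∀ l, a l = ∑ i, r l i • x i := by
  let e := Finite.equivFin ι
  obtain ⟨x, hx⟩ := hf (fun l => r (e.symm l)) (fun l => a (e.symm l)) b fun l => h _
  exact ⟨x, fun l => by simpa only [e.symm_apply_apply] using hx (e l)⟩

theorem ReflectsLinearSystems.balancedMap_injective {f : A →ₗ[R] B}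
    (hf : ReflectsLinearSystems f) : Function.Injective (balancedMap M f) := by
  classical
  refine (injective_iff_map_eq_zero _).2 fun t ht => ?_
  obtain ⟨w, rfl⟩ := t.exists_finsupp_sum_eq
  obtain ⟨p, ρ, b, hρ, hb⟩ := exists_relations_of_sum_eq_zero (w := w.mapRange f (map_zero f)) (by
    rw [Finsupp.sum_mapRange_index fun _ => map_zero _, ← ht, Finsupp.sum, Finsupp.sum, map_sum]
    rfl)
  let S : Finset M := w.support ∪ Finset.univ.biUnion fun j => (ρ j).support
  obtain ⟨x, hx⟩ := hf.exists_solution (fun (m : S) j => (ρ j m).unop) (fun m => w m) b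
    fun m => hb m
  have hρS (j : Fin p) : ∑ m ∈ S, ρ j m • m = 0 := by
    rw [← hρ j, Finsupp.linearCombination_apply]
    exact (Finsupp.sum_of_support_subset (ρ j) ((Finset.subset_biUnion_of_mem
      (fun j => (ρ j).support) (Finset.mem_univ j)).trans Finset.subset_union_right)
      (fun m r => r • m) fun m _ => zero_smul Rᵐᵒᵖ m).symm
  calc (w.sum fun m a => pureTensor R m a)
      = ∑ m ∈ S, pureTensor R m (w m) :=
        Finsupp.sum_of_support_subset _ Finset.subset_union_left _ fun _ _ => map_zero _
    _ = ∑ m ∈ S, ∑ j, pureTensor R (ρ j m • m) (x j) := by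
        refine Finset.sum_congr rfl fun m hm => ?_
        rw [hx ⟨m, hm⟩, map_sum]
        exact Finset.sum_congr rfl fun j _ => pureTensor_smul _ _ _
    _ = ∑ j, pureTensor R (∑ m ∈ S, ρ j m • m) (x j) := by
        rw [Finset.sum_comm]
        refine Finset.sum_congr rfl fun j _ => ?_
        rw [map_sum, AddMonoidHom.finsetSum_apply]
    _ = 0 := Finset.sum_eq_zero fun j _ => by rw [hρS, map_zero, AddMonoidHom.zero_apply]

theorem ReflectsLinearSystems.pi {ι : Type*} {A B : ι → Type*} [∀ k, AddCommGroup (A k)]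
    [∀ k, Module R (A k)] [∀ k, AddCommGroup (B k)] [∀ k, Module R (B k)]
    {f : ∀ k, A k →ₗ[R] B k} (hf : ∀ k, ReflectsLinearSystems (f k)) :
    ReflectsLinearSystems (LinearMap.piMap f) := by
  intro q p r a b h
  choose x hx using fun k => hf k r (fun l => a l k) (fun i => b i k) fun l => by
    simpa [Finset.sum_apply] using congrFun (h l) k
  exact ⟨fun i k => x k i, fun l => funext fun k => by
    simpa [Finset.sum_apply] using hx k l⟩

end LinearSystems

/-! ### Character modules -/

section Characters

variable {R : Type u} [Ring R] {A : Type*} [AddCommGroup A] [Module R A]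
  {M : Type*} [AddCommGroup M] [Module Rᵐᵒᵖ M]

/-- The action `(χ r) a = χ (r a)` on the characters of a left module. -/
noncomputable instance : Module Rᵐᵒᵖ (CharacterModule A) :=
  inferInstanceAs (Module Rᵈᵐᵃ (A →+ AddCircle (1 : ℚ)))

/-- The action `(r χ) m = χ (m r)` on the characters of a right module. -/
noncomputable instance : Module R (CharacterModule M) :=
  Module.compHom (R := (Rᵐᵒᵖ)ᵈᵐᵃ) (M →+ AddCircle (1 : ℚ)) (RingEquiv.opOp R).toRingHom

theorem character_sum_apply {ι : Type*} (s : Finset ι) (χ : ι → CharacterModule A)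
    (a : A) : (∑ i ∈ s, χ i) a = ∑ i ∈ s, χ i a :=
  AddMonoidHom.finsetSum_apply (M := A) (N := AddCircle (1 : ℚ)) χ s a

variable (R A) in
/-- The canonical map from a left module to its double character module. -/
noncomputable def toBidual : A →ₗ[R] CharacterModule (CharacterModule A) where
  toFun := AddMonoidHom.eval (M := A) (N := AddCircle (1 : ℚ))
  map_add' := map_add _
  map_smul' _ _ := rfl

theorem toBidual_apply (a : A) (χ : CharacterModule A) : toBidual R A a χ = χ a := rfl

theorem exists_character_separating_range {G H : Type*} [AddCommGroup G] [AddCommGroup H]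
    (θ : G →+ H) {h : H} (hh : h ∉ θ.range) :
    ∃ χ : CharacterModule H, (∀ g, χ (θ g) = 0) ∧ χ h ≠ 0 := by
  obtain ⟨χ, hχ⟩ := CharacterModule.exists_character_apply_ne_zero_of_ne_zero
    (mt (QuotientAddGroup.eq_zero_iff h).1 hh)
  refine ⟨AddMonoidHom.comp χ (QuotientAddGroup.mk' θ.range), fun g => ?_, hχ⟩
  exact (congrArg χ ((QuotientAddGroup.eq_zero_iff (θ g)).2 ⟨g, rfl⟩)).trans (map_zero χ)

theorem exists_characters_of_not_solvable {q p : ℕ} (r : Fin q → Fin p → R) (a : Fin q → A)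
    (ha : ¬ ∃ x : Fin p → A, ∀ l, a l = ∑ i, r l i • x i) :
    ∃ χ : Fin q → CharacterModule A,
      (∀ i, ∑ l, MulOpposite.op (r l i) • χ l = 0) ∧ ∑ l, χ l (a l) ≠ 0 := by
  let θ : (Fin p → A) →+ (Fin q → A) :=
    (LinearMap.pi fun l => ∑ i, DistribSMul.toLinearMap ℤ A (r l i) ∘ₗ
      LinearMap.proj i).toAddMonoidHom
  have hθ (x l) : θ x l = ∑ i, r l i • x i := by simp [θ]
  obtain ⟨ξ, hξ, hξa⟩ := exists_character_separating_range θ (h := a) fun ⟨x, hx⟩ =>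
    ha ⟨x, fun l => by rw [← hx, hθ]⟩
  have hsum (b : Fin q → A) : ξ b = ∑ l, ξ (Pi.single l (b l)) := by
    rw [← map_sum, Finset.univ_sum_single]
  refine ⟨fun l => AddMonoidHom.comp ξ (AddMonoidHom.single (fun _ => A) l),
    fun i => DFunLike.ext _ _ fun x => ?_, fun h => hξa ((hsum a).trans h)⟩
  have hx := hξ (Pi.single i x)
  rw [hsum] at hx
  simp only [hθ, Pi.single_apply, smul_ite, smul_zero, Finset.sum_ite_eq', Finset.mem_univ,
    if_true] at hx
  rw [character_sum_apply]
  exact hx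

theorem reflectsLinearSystems_toBidual : ReflectsLinearSystems (toBidual R A) := by
  intro q p r a w h
  by_contra hns
  obtain ⟨χ, hχ, hχa⟩ := exists_characters_of_not_solvable r a hns
  refine hχa ?_
  calc ∑ l, χ l (a l)
      = ∑ l, ∑ i, w i (MulOpposite.op (r l i) • χ l) := Finset.sum_congr rfl fun l _ => by
        rw [← toBidual_apply (R := R), h l, character_sum_apply]
        rfl
    _ = ∑ i, w i (∑ l, MulOpposite.op (r l i) • χ l) := by
        rw [Finset.sum_comm]
        exact Finset.sum_congr rfl fun i _ => (map_sum (w i) _ _).symm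
    _ = 0 := Finset.sum_eq_zero fun i _ => by rw [hχ, map_zero]

end Characters

/-! ### Pure injectivity -/

section PureInjective

variable {R : Type u} [Ring R]

/-- A strengthening of pure injectivity that passes from modules to complexes: the extensions
along a given pure monomorphism can be chosen additively. -/
def HasAdditiveExtensions (J : ModuleCat.{v} R) : Prop :=
  ∀ ⦃A B : ModuleCat.{v} R⦄ (f : A ⟶ B), IsPureMono f →
    ∃ e : (A ⟶ J) →+ (B ⟶ J), ∀ h, f ≫ e h = h

theorem HasAdditiveExtensions.isPureInjective {J : ModuleCat.{v} R}
    (hJ : HasAdditiveExtensions J) : IsPureInjective J := fun _ _ f hf h =>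
  let ⟨e, he⟩ := hJ f hf
  ⟨e h, he h⟩

section Evaluation

variable (P : Type v) [AddCommGroup P] [Module Rᵐᵒᵖ P] (A : ModuleCat.{v} R)

/-- The evaluation pairing `(P ⊗_ℤ Hom_R(A, P⋆)) ⊗_R A → ℚ/ℤ`, whose factor `P` is lifted to the
universe of the right modules that test purity. An extension of it along a pure monomorphism
`A ⟶ B` extends all maps from `A` to `P⋆` at once, hence additively. -/
noncomputable def evaluationPairing :
    CharacterModule (BalancedTensor R
      (ULift.{u} P ⊗[ℤ] (A ⟶ ModuleCat.of R (CharacterModule P))) A) :=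
  let ev : ULift.{u} P →+ (A ⟶ ModuleCat.of R (CharacterModule P)) →+ A →+ AddCircle (1 : ℚ) :=
    AddMonoidHom.mk' (fun p => AddMonoidHom.mk' (fun h => AddMonoidHom.mk'
      (fun a => (h.hom a : CharacterModule P) p.down)
      fun a b => by rw [map_add]; rfl) fun _ _ => rfl)
      fun p q => AddMonoidHom.ext fun h => AddMonoidHom.ext fun a =>
        map_add (h.hom a : CharacterModule P) _ _
  (balancedLift (TensorProduct.liftAddHom ev fun n p h => AddMonoidHom.ext fun a => by
      rw [map_zsmul, map_zsmul]
      rfl)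
    fun t r a => by
      induction t using TensorProduct.induction_on with
      | zero => rw [smul_zero, map_zero]; rfl
      | tmul p h =>
        exact DFunLike.congr_fun (h.hom.map_smul r a) p.down
      | add x y hx hy =>
        rw [smul_add, map_add, map_add]
        exact congrArg₂ (· + ·) hx hy).toAddMonoidHom

end Evaluation

theorem hasAdditiveExtensions_character (P : Type v) [AddCommGroup P] [Module Rᵐᵒᵖ P] :
    HasAdditiveExtensions (ModuleCat.of R (CharacterModule P)) := by
  rintro A B f ⟨C, g, hfg⟩
  obtain ⟨χ, hχ⟩ := CharacterModule.dual_surjective_of_injective _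
    (hfg.tensor (ULift.{u} P ⊗[ℤ] (A ⟶ ModuleCat.of R (CharacterModule P)))).1
    (evaluationPairing P A)
  let e (h : A ⟶ ModuleCat.of R (CharacterModule P)) : B →ₗ[R] CharacterModule P :=
    { toFun b := AddMonoidHom.mk' (fun p => χ (pureTensor R (ULift.up p ⊗ₜ[ℤ] h) b)) fun p p' => by
        rw [← map_add, ← AddMonoidHom.add_apply, ← map_add, ← TensorProduct.add_tmul]
        rfl
      map_add' b b' := DFunLike.ext _ _ fun p =>
        (congrArg χ (map_add (pureTensor R _) b b')).trans (map_add χ _ _)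
      map_smul' r b := DFunLike.ext _ _ fun p => congrArg χ (pureTensor_smul _ r b) }
  refine ⟨AddMonoidHom.mk' (fun h => ModuleCat.ofHom (e h)) fun h h' => ?_, fun h => ?_⟩
  · ext b p
    change χ _ = χ _ + χ _
    rw [← map_add, ← AddMonoidHom.add_apply, ← map_add, ← TensorProduct.tmul_add]
  · ext a p
    exact DFunLike.congr_fun hχ (pureTensor R (ULift.up p ⊗ₜ[ℤ] h) a)

theorem isPureInjective_of_isLimit_fan {ι : Type*} {I : ModuleCat.{v} R}
    {J : ι → ModuleCat.{v} R} {π : ∀ l, I ⟶ J l} (hI : Limits.IsLimit (Limits.Fan.mk I π))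
    (hJ : ∀ l, IsPureInjective (J l)) : IsPureInjective I := by
  intro A B f hf h
  choose k hk using fun l => hJ l f hf (h ≫ π l)
  exact ⟨Limits.Fan.IsLimit.lift hI k, Limits.Fan.IsLimit.hom_ext hI _ _ fun l => by
    rw [Category.assoc, Limits.Fan.IsLimit.fac]; exact hk l⟩

end PureInjective

/-! ### Pure exactness as acyclicity after tensoring -/

section PureExact

variable {R : Type u} [Ring R]

theorem IsPureShortExact.of_injective {A B C : Type v} [AddCommGroup A] [Module R A]
    [AddCommGroup B] [Module R B] [AddCommGroup C] [Module R C] {f : A →ₗ[R] B} {g : B →ₗ[R] C}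
    (hf : Function.Injective f) (hfg : Function.Exact f g) (hg : Function.Surjective g)
    (hM : ∀ (M : Type (max u v)) [AddCommGroup M] [Module Rᵐᵒᵖ M],
      Function.Injective (balancedMap M f)) : IsPureShortExact f g :=
  ⟨hf, hfg, hg, fun M _ _ => ⟨hM M, balancedMap_exact hfg hg, balancedMap_surjective hg⟩⟩

theorem IsPureShortExact.subtype_mkQ {A : Type v} [AddCommGroup A] [Module R A] (K : Submodule R A)
    (hK : ∀ (M : Type (max u v)) [AddCommGroup M] [Module Rᵐᵒᵖ M],
      Function.Injective (balancedMap M K.subtype)) : IsPureShortExact K.subtype K.mkQ :=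
  .of_injective K.injective_subtype (LinearMap.exact_subtype_mkQ K) K.mkQ_surjective hK

theorem IsPureExactAt.exact {X : CochainComplex (ModuleCat.{v} R) ℤ} {n : ℤ}
    (h : IsPureExactAt X n) :
    Function.Exact (X.d (n - 1) n).hom (X.d n (n + 1)).hom := by
  refine LinearMap.exact_iff.2 ?_
  simpa using (LinearMap.exact_iff.1 h.ses.exact).symm

theorem IsPureExact.exists_factorization {E : CochainComplex (ModuleCat.{v} R) ℤ}
    (hE : IsPureExact E) (i j k : ℤ) (hij : i + 1 = j) (hjk : j + 1 = k) :
    ∃ (D : ModuleCat.{v} R) (p : E.X j ⟶ D) (ι : D ⟶ E.X k), Function.Surjective p.hom ∧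
      IsPureMono ι ∧ p ≫ ι = E.d j k ∧ Function.Exact (E.d i j).hom p.hom := by
  obtain rfl : i = j - 1 := by omega
  subst hjk
  obtain ⟨D, p, ι, ⟨A, f, hfp⟩, ⟨C, g, hιg⟩, hd⟩ := (hE j).decomposable_next
  refine ⟨D, p, ι, hfp.surjective, ⟨C, g, hιg⟩, hd, fun x => ?_⟩
  rw [← (hE j).exact x, ← hd, ModuleCat.hom_comp, LinearMap.comp_apply,
    map_eq_zero_iff _ hιg.injective]

theorem IsPureExact.exact_balancedMap {X : CochainComplex (ModuleCat.{v} R) ℤ}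
    (hX : IsPureExact X) (i j k : ℤ) (hij : i + 1 = j) (hjk : j + 1 = k) (M : Type (max u v))
    [AddCommGroup M] [Module Rᵐᵒᵖ M] :
    Function.Exact (balancedMap M (X.d i j).hom) (balancedMap M (X.d j k).hom) := by
  obtain ⟨D, p, ι, hp, ⟨C, g, hιg⟩, hd, hdp⟩ := hX.exists_factorization i j k hij hjk
  have := (balancedMap_exact (M := M) hdp hp).comp_injective _ (hιg.tensor M).1 (map_zero _)
  rwa [← LinearMap.coe_comp, ← balancedMap_comp, ← ModuleCat.hom_comp, hd] at this

/-- The canonical map `R ⊗_R A → A`, for a copy of `R` in another universe. -/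
def unitTensor (A : Type*) [AddCommGroup A] [Module R A] :
    BalancedTensor R (ULift.{v} R) A →ₗ[ℤ] A :=
  balancedLift (AddMonoidHom.mk' (fun r => DistribSMul.toAddMonoidHom A r.down)
    fun r s => AddMonoidHom.ext (add_smul r.down s.down)) fun r s a => (mul_smul r.down s a).symm

theorem unitTensor_one {A : Type*} [AddCommGroup A] [Module R A] (a : A) :
    unitTensor A (pureTensor R (ULift.up.{v} 1) a) = a := one_smul R a

theorem unitTensor_balancedMap {A B : Type*} [AddCommGroup A] [Module R A] [AddCommGroup B]
    [Module R B] (f : A →ₗ[R] B) (t : BalancedTensor R (ULift.{v} R) A) :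
    unitTensor B (balancedMap _ f t) = f (unitTensor A t) :=
  LinearMap.congr_fun (f := unitTensor B ∘ₗ balancedMap _ f)
    (g := f.toAddMonoidHom.toIntLinearMap ∘ₗ unitTensor A)
    (BalancedTensor.hom_ext fun r a => (f.map_smul r.down a).symm) t

theorem exact_of_exact_balancedMap {A B C : Type*} [AddCommGroup A] [Module R A]
    [AddCommGroup B] [Module R B] [AddCommGroup C] [Module R C] {f : A →ₗ[R] B} {g : B →ₗ[R] C}
    (h : Function.Exact (balancedMap (ULift.{v} R) f) (balancedMap (ULift.{v} R) g)) :
    Function.Exact f g := by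
  intro b
  constructor
  · intro hb
    obtain ⟨t, ht⟩ := (h (pureTensor R (ULift.up 1) b)).1 (by
      rw [balancedMap_pureTensor, hb, map_zero])
    exact ⟨unitTensor A t, by rw [← unitTensor_balancedMap, ht, unitTensor_one]⟩
  · rintro ⟨a, rfl⟩
    rw [← unitTensor_one (R := R) (g (f a)), ← balancedMap_pureTensor, ← balancedMap_pureTensor,
      h.apply_apply_eq_zero, map_zero]

/-- The differential `d i j` of a complex as a map onto the cycles in degree `j`. -/
noncomputable def toKer (X : CochainComplex (ModuleCat.{v} R) ℤ) (i j k : ℤ) :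
    X.X i →ₗ[R] LinearMap.ker (X.d j k).hom :=
  (X.d i j).hom.codRestrict _ fun x => LinearMap.congr_fun
    (congrArg ModuleCat.Hom.hom (X.d_comp_d i j k)) x

theorem toKer_surjective {X : CochainComplex (ModuleCat.{v} R) ℤ} {i j k : ℤ}
    (h : Function.Exact (X.d i j).hom (X.d j k).hom) : Function.Surjective (toKer X i j k) := by
  rintro ⟨y, hy⟩
  obtain ⟨x, rfl⟩ := (h y).1 hy
  exact ⟨x, rfl⟩

section Cycles

variable {X : CochainComplex (ModuleCat.{v} R) ℤ}
  (hX : ∀ i j k : ℤ, i + 1 = j → j + 1 = k → ∀ (M : Type (max u v)) [AddCommGroup M]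
    [Module Rᵐᵒᵖ M], Function.Exact (balancedMap M (X.d i j).hom) (balancedMap M (X.d j k).hom))

include hX

theorem toKer_surjective_of_exact_balancedMap (i j k : ℤ) (hij : i + 1 = j) (hjk : j + 1 = k) :
    Function.Surjective (toKer X i j k) :=
  toKer_surjective (exact_of_exact_balancedMap (hX i j k hij hjk (ULift.{v} R)))

theorem balancedMap_ker_subtype_injective (j k : ℤ) (hjk : j + 1 = k) (M : Type (max u v))
    [AddCommGroup M] [Module Rᵐᵒᵖ M] :
    Function.Injective (balancedMap M (LinearMap.ker (X.d j k).hom).subtype) := by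
  refine (injective_iff_map_eq_zero _).2 fun t ht => ?_
  have hij : j - 1 + 1 = j := sub_add_cancel j 1
  obtain ⟨y, rfl⟩ := balancedMap_surjective (M := M)
    (toKer_surjective_of_exact_balancedMap hX (j - 1) j k hij hjk) t
  rw [← LinearMap.comp_apply, ← balancedMap_comp] at ht
  obtain ⟨z, rfl⟩ := (hX (j - 2) (j - 1) j (by omega) hij M y).1 ht
  rw [← LinearMap.comp_apply, ← balancedMap_comp]
  have h0 : toKer X (j - 1) j k ∘ₗ (X.d (j - 2) (j - 1)).hom = 0 := LinearMap.ext fun x =>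
    Subtype.ext (LinearMap.congr_fun (congrArg ModuleCat.Hom.hom (X.d_comp_d _ _ j)) x)
  rw [h0, balancedMap_zero, LinearMap.zero_apply]

theorem isPureDecomposable_d (i j : ℤ) (hij : i + 1 = j) : IsPureDecomposable (X.d i j) := by
  have hK := balancedMap_ker_subtype_injective hX
  refine ⟨ModuleCat.of R (LinearMap.ker (X.d j (j + 1)).hom), ModuleCat.ofHom (toKer X i j (j + 1)),
    ModuleCat.ofHom (LinearMap.ker (X.d j (j + 1)).hom).subtype,
    ⟨ModuleCat.of R (LinearMap.ker (X.d i j).hom), ModuleCat.ofHom (Submodule.subtype _), ?_⟩,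
    ⟨ModuleCat.of R _, ModuleCat.ofHom (Submodule.mkQ _), .subtype_mkQ _ (hK j (j + 1) rfl)⟩, rfl⟩
  refine .of_injective Subtype.val_injective (LinearMap.exact_iff.2 ?_)
    (toKer_surjective_of_exact_balancedMap hX i j (j + 1) hij rfl) (hK i j hij)
  exact (LinearMap.ker_codRestrict _ _ _).trans (Submodule.range_subtype _).symm

end Cycles

theorem isPureExact_iff_exact_balancedMap {X : CochainComplex (ModuleCat.{v} R) ℤ} :
    IsPureExact X ↔ ∀ i j k : ℤ, i + 1 = j → j + 1 = k → ∀ (M : Type (max u v)) [AddCommGroup M]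
      [Module Rᵐᵒᵖ M],
        Function.Exact (balancedMap M (X.d i j).hom) (balancedMap M (X.d j k).hom) := by
  refine ⟨IsPureExact.exact_balancedMap, fun hX n =>
    ⟨isPureDecomposable_d hX _ _ (by omega), isPureDecomposable_d hX _ _ rfl, ?_⟩⟩
  rw [← LinearMap.exact_iff.1 (exact_of_exact_balancedMap
    (hX (n - 1) n (n + 1) (by omega) rfl (ULift.{v} R)))]
  exact .subtype_mkQ _ (balancedMap_ker_subtype_injective hX _ _ rfl)

theorem isPureExact_iff_acyclic {X : CochainComplex (ModuleCat.{v} R) ℤ} :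
    IsPureExact X ↔ ∀ (M : Type (max u v)) [AddCommGroup M] [Module Rᵐᵒᵖ M],
      (((tensorFunctor R M).mapHomologicalComplex _).obj X).Acyclic := by
  rw [isPureExact_iff_exact_balancedMap]
  refine ⟨fun h M _ _ n => ?_, fun h i j k hij hjk M _ _ => ?_⟩
  · rw [HomologicalComplex.exactAt_iff' _ (n - 1) n (n + 1) (by simp) (by simp)]
    exact (ShortComplex.ShortExact.moduleCat_exact_iff_function_exact _).2
      (h (n - 1) n (n + 1) (by omega) rfl M)
  · have := h M j
    rw [HomologicalComplex.exactAt_iff' _ i j k (by simp; omega) (by simp; omega)] at this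
    exact (ShortComplex.ShortExact.moduleCat_exact_iff_function_exact _).1 this

theorem IsPureExact.of_iso {X Y : CochainComplex (ModuleCat.{v} R) ℤ} (hX : IsPureExact X)
    (e : X ≅ Y) : IsPureExact Y :=
  isPureExact_iff_acyclic.2 fun M _ _ n => (isPureExact_iff_acyclic.1 hX M n).of_iso
    (((tensorFunctor R M).mapHomologicalComplex _).mapIso e)

theorem IsPureExact.shift {X : CochainComplex (ModuleCat.{v} R) ℤ} (hX : IsPureExact X) (n : ℤ) :
    IsPureExact (X⟦n⟧) := by
  refine isPureExact_iff_acyclic.2 fun M _ _ i => .of_iso ?_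
    (((tensorFunctor R M).mapCochainComplexShiftIso n).app X).symm
  have h := isPureExact_iff_acyclic.1 hX M (n + i)
  rw [HomologicalComplex.exactAt_iff_isZero_homology] at h ⊢
  exact h.of_iso (((HomologicalComplex.homologyFunctor (ModuleCat ℤ) (.up ℤ) 0).shiftIso
    n i (n + i) rfl).app _)

end PureExact

/-! ### Maps from a pure exact complex -/

section Contraction

variable {R : Type u} [Ring R]

theorem exists_addHom_comp_eq {A B D J : ModuleCat.{v} R} {f : A ⟶ B} {p : B ⟶ D}
    (hp : Function.Surjective p.hom) (hfp : Function.Exact f.hom p.hom) {G : Type*}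
    [AddCommGroup G] (s : G →+ (B ⟶ J)) (hs : ∀ g, f ≫ s g = 0) :
    ∃ r : G →+ (D ⟶ J), ∀ g, p ≫ r g = s g := by
  have : Epi p := (ModuleCat.epi_iff_surjective p).2 hp
  have hS : (ShortComplex.mk f p (ModuleCat.hom_ext hfp.linearMap_comp_eq_zero)).Exact :=
    (ShortComplex.ShortExact.moduleCat_exact_iff_function_exact _).2 hfp
  exact ⟨AddMonoidHom.mk' (fun g => hS.desc (s g) (hs g)) fun g g' => by
    rw [← cancel_epi p, Preadditive.comp_add, hS.g_desc, hS.g_desc, hS.g_desc, map_add],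
    fun g => hS.g_desc _ _⟩

theorem IsPureExact.exists_contraction {E : CochainComplex (ModuleCat.{v} R) ℤ}
    (hE : IsPureExact E) {J : ModuleCat.{v} R} (hJ : HasAdditiveExtensions J) :
    ∃ κ : ∀ i j : ℤ, i + 1 = j → ((E.X i ⟶ J) →+ (E.X j ⟶ J)),
      ∀ (i j k : ℤ) (hij : i + 1 = j) (hjk : j + 1 = k) (g : E.X j ⟶ J),
        E.d j k ≫ κ j k hjk g + κ i j hij (E.d i j ≫ g) = g := by
  choose D p ι hp hι hpι hdp using fun i j hij =>
    hE.exists_factorization (i - 1) i j (sub_add_cancel i 1) hij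
  choose e he using fun i j hij => hJ (ι i j hij) (hι i j hij)
  have hp' (i j hij) : Epi (p i j hij) := (ModuleCat.epi_iff_surjective _).2 (hp i j hij)
  let s (i j hij) : (E.X j ⟶ J) →+ (E.X j ⟶ J) :=
    .id _ - (e i j hij).comp (Preadditive.leftComp J (ι i j hij))
  have hs (i j hij g) : s i j hij g = g - e i j hij (ι i j hij ≫ g) := rfl
  have hιs (i j hij g) : ι i j hij ≫ s i j hij g = 0 := by
    rw [hs, Preadditive.comp_sub, he, sub_self]
  choose r hr using fun i j hij => exists_addHom_comp_eq (hp i j hij) (hdp i j hij)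
    (s (i - 1) i (sub_add_cancel i 1)) fun g => by
      rw [← hpι _ _ (sub_add_cancel i 1), Category.assoc, hιs, Limits.comp_zero]
  have hιd (i j k : ℤ) (hij : i + 1 = j) : ι i j hij ≫ E.d j k = 0 := by
    rw [← cancel_epi (p i j hij), ← Category.assoc, hpι, E.d_comp_d, Limits.comp_zero]
  refine ⟨fun i j hij => (e i j hij).comp (r i j hij), fun i j k hij hjk g => ?_⟩
  have hrd : r i j hij (E.d i j ≫ g) = ι i j hij ≫ g := by
    rw [← cancel_epi (p i j hij), hr, ← Category.assoc, hpι]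
    rw [hs, ← Category.assoc, hιd, Limits.zero_comp, map_zero, sub_zero]
  obtain rfl : i = j - 1 := by omega
  rw [AddMonoidHom.comp_apply, AddMonoidHom.comp_apply, hrd, ← hpι j k hjk, Category.assoc, he,
    hr, hs, sub_add_cancel]

end Contraction

/-! ### Maps into a triangular product -/

section Unipotent

variable {A : Type*} [AddCommGroup A] {G : ℕ → Type*} [∀ l, AddCommGroup (G l)]
  {π : ∀ l, A →+ G l}

theorem bijective_id_sub_of_strictlyTriangular (hπ : Function.Bijective fun a l => π l a)
    {N : A →+ A} (hN : ∀ l a, (∀ j < l, π j a = 0) → π l (N a) = 0) :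
    Function.Bijective (AddMonoidHom.id A - N) := by
  constructor
  · refine (injective_iff_map_eq_zero _).2 fun a ha => hπ.1 (funext fun l => ?_)
    have ha : a = N a := sub_eq_zero.1 ha
    refine .trans ?_ (map_zero (π l)).symm
    induction l using Nat.strong_induction_on with
    | _ l ih => rw [ha]; exact hN l a ih
  · intro b
    -- The partial sums of the Neumann series `∑ N^k b`; the component `π l` is constant after `l`.
    let x : ℕ → A := Nat.rec 0 fun _ a => b + N a
    have hx (k : ℕ) : ∀ j < k, π j (x (k + 1) - x k) = 0 := by
      induction k with
      | zero => simp
      | succ k ih =>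
        intro j hj
        have hk : x (k + 2) - x (k + 1) = N (x (k + 1) - x k) := by
          rw [map_sub]; exact add_sub_add_left_eq_sub _ _ _
        rw [hk]
        exact hN j _ fun i hi => ih i (by omega)
    have hstable (j k : ℕ) (hjk : j < k) : π j (x k) = π j (x (j + 1)) := by
      induction k, hjk using Nat.le_induction with
      | base => rfl
      | succ k hk ih => rw [← ih, ← sub_eq_zero, ← map_sub]; exact hx k j hk
    obtain ⟨a, ha⟩ := hπ.2 fun l => π l (x (l + 1))
    have ha (l : ℕ) : π l a = π l (x (l + 1)) := congrFun ha l
    refine ⟨a, hπ.1 (funext fun l => ?_)⟩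
    have hl : π l (N (a - x l)) = 0 := hN l _ fun j hj => by
      rw [map_sub, ha, hstable j l hj, sub_self]
    have hxl : x (l + 1) = b + N (x l) := rfl
    rw [map_sub, map_sub, sub_eq_zero] at hl
    change π l (a - N a) = π l b
    rw [map_sub, ha, hl, hxl, map_add, add_sub_cancel_right]

end Unipotent

section HomComplex

variable {R : Type u} [Ring R]

/-- The structure of a degreewise product `∏ l, J l` on a complex `I`, whose differential
increases the index `l` strictly (`triangular` below, stated for generalized elements). -/
structure TriangularProduct (I : CochainComplex (ModuleCat.{v} R) ℤ) where
  layer : ℕ → ℤ → ModuleCat.{v} R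
  π (l : ℕ) (n : ℤ) : I.X n ⟶ layer l n
  isLimit (n : ℤ) : Limits.IsLimit (Limits.Fan.mk (I.X n) fun l => π l n)
  triangular (l : ℕ) (m n : ℤ) {A : ModuleCat.{v} R} (g : A ⟶ I.X m) :
    (∀ j < l, g ≫ π j m = 0) → (g ≫ I.d m n) ≫ π l n = 0

theorem IsPureExact.exists_contraction_of_isLimit_fan {E : CochainComplex (ModuleCat.{v} R) ℤ}
    (hE : IsPureExact E) {ι : Type*} {I : ModuleCat.{v} R} {J : ι → ModuleCat.{v} R}
    {π : ∀ l, I ⟶ J l} (hI : Limits.IsLimit (Limits.Fan.mk I π))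
    (hJ : ∀ l, HasAdditiveExtensions (J l)) :
    ∃ κ : ∀ i j : ℤ, i + 1 = j → ((E.X i ⟶ I) →+ (E.X j ⟶ I)),
      (∀ (i j k : ℤ) (hij : i + 1 = j) (hjk : j + 1 = k) (g : E.X j ⟶ I),
        E.d j k ≫ κ j k hjk g + κ i j hij (E.d i j ≫ g) = g) ∧
      ∀ (l : ι) (i j : ℤ) (hij : i + 1 = j) (g : E.X i ⟶ I),
        g ≫ π l = 0 → κ i j hij g ≫ π l = 0 := by
  choose κ hκ using fun l => hE.exists_contraction (hJ l)
  have ext {i} {g h : E.X i ⟶ I} (w : ∀ l, g ≫ π l = h ≫ π l) : g = h :=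
    Limits.Fan.IsLimit.hom_ext hI g h w
  let κI (i j : ℤ) (hij : i + 1 = j) (g : E.X i ⟶ I) : E.X j ⟶ I :=
    Limits.Fan.IsLimit.lift hI fun l => κ l i j hij (g ≫ π l)
  have hπ (i j hij g l) : κI i j hij g ≫ π l = κ l i j hij (g ≫ π l) :=
    Limits.Fan.IsLimit.fac hI _ l
  refine ⟨fun i j hij => AddMonoidHom.mk' (κI i j hij) fun g g' => ext fun l => ?_,
    fun i j k hij hjk g => ext fun l => ?_, fun l i j hij g hg => ?_⟩
  · simp only [hπ, Preadditive.add_comp, map_add]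
  · rw [Preadditive.add_comp, Category.assoc]
    simp only [AddMonoidHom.mk'_apply, hπ, Category.assoc]
    exact hκ l i j k hij hjk (g ≫ π l)
  · exact (hπ i j hij g l).trans (by rw [hg, map_zero])

section Acyclic

variable {E I : CochainComplex (ModuleCat.{v} R) ℤ}
open CochainComplex.HomComplex

/-- The cochain map of degree `-1` on `Hom(E, I)` that applies a family of maps
`Hom(E^i, I^q) → Hom(E^{i+1}, I^q)` componentwise. -/
def contractCochain (κ : ∀ q i j : ℤ, i + 1 = j → ((E.X i ⟶ I.X q) →+ (E.X j ⟶ I.X q)))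
    (n m : ℤ) (hmn : m + 1 = n) : Cochain E I n →+ Cochain E I m :=
  AddMonoidHom.mk' (fun φ => .mk fun p q hpq =>
    n.negOnePow • κ q (p - 1) p (by omega) (φ.v (p - 1) q (by omega))) fun φ ψ => by
      ext p q hpq
      simp only [Cochain.mk_v, Cochain.add_v, map_add, smul_add]

theorem contractCochain_v (κ : ∀ q i j : ℤ, i + 1 = j → ((E.X i ⟶ I.X q) →+ (E.X j ⟶ I.X q)))
    (n m : ℤ) (hmn : m + 1 = n) (φ : Cochain E I n) (p q : ℤ) (hpq : p + m = q) (p' : ℤ)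
    (hp' : p' + 1 = p) : (contractCochain κ n m hmn φ).v p q hpq =
      n.negOnePow • κ q p' p hp' (φ.v p' q (by omega)) := by
  obtain rfl : p' = p - 1 := by omega
  rfl

theorem contractCochain_δ_add_δ_contractCochain_v
    {κ : ∀ q i j : ℤ, i + 1 = j → ((E.X i ⟶ I.X q) →+ (E.X j ⟶ I.X q))}
    (hκ : ∀ (q i j k : ℤ) (hij : i + 1 = j) (hjk : j + 1 = k) (g : E.X j ⟶ I.X q),
        E.d j k ≫ κ q j k hjk g + κ q i j hij (E.d i j ≫ g) = g)
    (k n m : ℤ) (hkn : k + 1 = n) (hnm : n + 1 = m) (φ : Cochain E I n)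
    (p q p' q' : ℤ) (hpq : p + n = q) (hp : p' + 1 = p) (hq : q' + 1 = q) :
    (contractCochain κ m n hnm (δ n m φ) + δ k n (contractCochain κ n k hkn φ)).v p q hpq =
      φ.v p q hpq + n.negOnePow • (κ q' p' p hp (φ.v p' q' (by omega)) ≫ I.d q' q -
        κ q p' p hp (φ.v p' q' (by omega) ≫ I.d q' q)) := by
  rw [Cochain.add_v, add_comm, δ_v k n hkn _ p q hpq q' (p + 1) (by omega) rfl,
    contractCochain_v _ _ _ _ _ _ _ _ p' hp, contractCochain_v _ _ _ _ _ _ _ _ p rfl,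
    contractCochain_v _ _ _ _ _ _ _ _ p' hp, δ_v n m hnm _ p' q (by omega) q' p (by omega) hp]
  have hε (y : E.X p ⟶ I.X q) : n.negOnePow • n.negOnePow • y = y := by
    rw [smul_smul, ← Int.negOnePow_add, Int.negOnePow_even _ ⟨n, rfl⟩, one_smul]
  have hκε (y : E.X p' ⟶ I.X q) :
      κ q p' p hp (n.negOnePow • y) = n.negOnePow • κ q p' p hp y :=
    map_zsmul _ (n.negOnePow : ℤ) y
  have hm : m.negOnePow = -n.negOnePow := by rw [← hnm, Int.negOnePow_succ]
  rw [hm, Units.neg_smul, Units.neg_smul, map_add, map_neg, hκε,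
    Linear.comp_units_smul, Linear.units_smul_comp, hε, smul_add, smul_neg, hε, smul_sub]
  conv_rhs => rw [← hκ q p' p (p + 1) hp rfl (φ.v p q hpq)]
  abel

/-- The degreewise components of a cochain with values in a triangular product. -/
def cochainComponent (T : TriangularProduct I) (n : ℤ) (l : ℕ) :
    Cochain E I n →+ ∀ t : Triplet n, (E.X t.p ⟶ T.layer l t.q) :=
  AddMonoidHom.mk' (fun φ t => φ.v t.p t.q t.hpq ≫ T.π l t.q) fun φ ψ => by
    ext1 t
    simp only [Cochain.add_v, Preadditive.add_comp, Pi.add_apply]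

theorem cochainComponent_bijective (T : TriangularProduct I) (n : ℤ) :
    Function.Bijective fun (φ : Cochain E I n) l => cochainComponent T n l φ := by
  constructor
  · refine fun φ ψ h => Cochain.ext _ _ fun p q hpq =>
      Limits.Fan.IsLimit.hom_ext (T.isLimit q) _ _ fun l => ?_
    exact congrFun (congrFun h l) ⟨p, q, hpq⟩
  · refine fun ψ => ⟨.mk fun p q hpq => Limits.Fan.IsLimit.lift (T.isLimit q) fun l =>
      ψ l ⟨p, q, hpq⟩, funext₂ fun l t => ?_⟩
    exact Limits.Fan.IsLimit.fac (T.isLimit t.q) _ l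

theorem TriangularProduct.bijective_contractCochain_δ_add_δ_contractCochain
    (T : TriangularProduct I)
    {κ : ∀ q i j : ℤ, i + 1 = j → ((E.X i ⟶ I.X q) →+ (E.X j ⟶ I.X q))}
    (hκ : ∀ (q i j k : ℤ) (hij : i + 1 = j) (hjk : j + 1 = k) (g : E.X j ⟶ I.X q),
        E.d j k ≫ κ q j k hjk g + κ q i j hij (E.d i j ≫ g) = g)
    (hκπ : ∀ (q : ℤ) (l : ℕ) (i j : ℤ) (hij : i + 1 = j) (g : E.X i ⟶ I.X q),
      g ≫ T.π l q = 0 → κ q i j hij g ≫ T.π l q = 0)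
    (k n m : ℤ) (hkn : k + 1 = n) (hnm : n + 1 = m) :
    Function.Bijective fun φ : Cochain E I n =>
      contractCochain κ m n hnm (δ n m φ) + δ k n (contractCochain κ n k hkn φ) := by
  let u : Cochain E I n →+ Cochain E I n :=
    (contractCochain κ m n hnm).comp (δ_hom ℤ E I n m).toAddMonoidHom +
      (δ_hom ℤ E I k n).toAddMonoidHom.comp (contractCochain κ n k hkn)
  have h := bijective_id_sub_of_strictlyTriangular (cochainComponent_bijective (E := E) T n)
    (N := .id _ - u) fun l φ hφ => funext fun ⟨p, q, hpq⟩ => ?_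
  · rwa [sub_sub_cancel] at h
  · have hx : ∀ j < l, φ.v (p - 1) (q - 1) (by omega) ≫ T.π j (q - 1) = 0 := fun j hj =>
      congrFun (hφ j hj) ⟨p - 1, q - 1, by omega⟩
    have hu := contractCochain_δ_add_δ_contractCochain_v hκ k n m hkn hnm φ p q (p - 1) (q - 1)
      hpq (by omega) (by omega)
    change (φ.v p q hpq - (contractCochain κ m n hnm (δ n m φ) +
      δ k n (contractCochain κ n k hkn φ)).v p q hpq) ≫ T.π l q = 0
    rw [hu, sub_add_cancel_left, Preadditive.neg_comp, Linear.units_smul_comp,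
      Preadditive.sub_comp, T.triangular l _ _ _ fun j hj => hκπ _ _ _ _ _ _ (hx j hj),
      hκπ _ _ _ _ _ _ (T.triangular l _ _ _ hx), sub_zero, smul_zero, neg_zero]

theorem acyclic_mapHomologicalComplex_of_isIso {C D : Type*} [Category* C] [Preadditive C]
    [Category* D] [Preadditive D] [CategoryWithHomology D] (F : C ⥤ D) [F.Additive]
    {ι : Type*} {c : ComplexShape ι} {K : HomologicalComplex C c} (u : K ⟶ K) [IsIso u]
    (h : Homotopy u 0) : ((F.mapHomologicalComplex c).obj K).Acyclic := by
  intro n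
  rw [HomologicalComplex.exactAt_iff_isZero_homology]
  have hu : HomologicalComplex.homologyMap ((F.mapHomologicalComplex c).map u) n = 0 := by
    rw [(F.mapHomotopy h).homologyMap_eq n, Functor.map_zero, HomologicalComplex.homologyMap_zero]
  exact Limits.IsZero.of_mono_eq_zero _ hu

theorem TriangularProduct.homComplex_isPureExact (T : TriangularProduct I)
    (hT : ∀ l n, HasAdditiveExtensions (T.layer l n)) (hE : IsPureExact E) :
    IsPureExact (homComplex E I) := by
  choose κ hκ hκπ using fun q =>
    hE.exists_contraction_of_isLimit_fan (T.isLimit q) fun l => hT l q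
  let u : CochainComplex.HomComplex E I ⟶ CochainComplex.HomComplex E I :=
    Homotopy.nullHomotopicMap' fun n m hmn =>
      AddCommGrpCat.ofHom (contractCochain κ n m hmn)
  have hu : IsIso u := by
    have (n : ℤ) : IsIso (u.f n) := by
      refine (ConcreteCategory.isIso_iff_bijective _).2 ?_
      rw [show u.f n = _ from Homotopy.nullHomotopicMap'_f (k₂ := n - 1) (k₀ := n + 1)
        (sub_add_cancel n 1) rfl _]
      exact T.bijective_contractCochain_δ_add_δ_contractCochain hκ hκπ (n - 1) n (n + 1)
        (sub_add_cancel n 1) rfl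
    exact HomologicalComplex.Hom.isIso_of_components u
  exact isPureExact_iff_acyclic.2 fun M _ _ => acyclic_mapHomologicalComplex_of_isIso
    (K := CochainComplex.HomComplex E I)
    (toIntModule ⋙ tensorFunctor ℤ M) u (Homotopy.nullHomotopy' _)

end Acyclic
end HomComplex

/-! ### Limits of degreewise split towers -/

section Tower

theorem homologyMap_eq_zero {S : Type u} [Ring S] {κ : Type*} {c : ComplexShape κ}
    {K L : HomologicalComplex (ModuleCat.{v} S) c} (φ : K ⟶ L) {i j k : κ}
    (h : ∀ z : K.X j, K.d j k z = 0 → ∃ w, L.d i j w = φ.f j z) :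
    HomologicalComplex.homologyMap φ j = 0 := by
  rw [← cancel_epi (K.homologyπ j), HomologicalComplex.homologyπ_naturality, Limits.comp_zero]
  ext z
  obtain ⟨w, hw⟩ := h (K.iCycles j z)
    (by rw [← ConcreteCategory.comp_apply, K.iCycles_d]; rfl)
  have hz : L.toCycles i j w = HomologicalComplex.cyclesMap φ j z := by
    refine (ModuleCat.mono_iff_injective (L.iCycles j)).1 inferInstance ?_
    rw [← ConcreteCategory.comp_apply, ← ConcreteCategory.comp_apply, L.toCycles_i,
      HomologicalComplex.cyclesMap_i, hw]
    rfl
  rw [ConcreteCategory.comp_apply, ← hz, ← ConcreteCategory.comp_apply,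
    L.toCycles_comp_homologyπ]
  rfl

section Kernel

variable {C : Type*} [Category* C] [Abelian C] {K L : CochainComplex C ℤ} (f : K ⟶ L) {n : ℤ}

instance : Mono ((ShortComplex.kernelSequence f).map (HomologicalComplex.eval C (.up ℤ) n)).f :=
  inferInstanceAs (Mono ((Limits.kernel.ι f).f n))

theorem kernelSequence_map_eval_exact :
    ((ShortComplex.kernelSequence f).map (HomologicalComplex.eval C (.up ℤ) n)).Exact :=
  (ShortComplex.kernelSequence_exact f).map_of_mono_of_preservesKernel _ inferInstance inferInstance

/-- The lift of a morphism to a kernel of complexes, in a single degree. -/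
noncomputable def kernelLift {A : C} (k : A ⟶ K.X n) (hk : k ≫ f.f n = 0) :
    A ⟶ (Limits.kernel f).X n :=
  (kernelSequence_map_eval_exact f).lift k hk

theorem kernelLift_ι {A : C} (k : A ⟶ K.X n) (hk : k ≫ f.f n = 0) :
    kernelLift f k hk ≫ (Limits.kernel.ι f).f n = k :=
  (kernelSequence_map_eval_exact f).lift_f k hk

/-- A section in a single degree of a morphism of complexes splits the inclusion of its kernel. -/
noncomputable def kernelSplitting (s : L.X n ⟶ K.X n) (hs : s ≫ f.f n = 𝟙 _) :
    ((ShortComplex.kernelSequence f).map (HomologicalComplex.eval C (.up ℤ) n)).Splitting :=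
  .ofExactOfSection _ (kernelSequence_map_eval_exact f) s hs inferInstance

end Kernel

variable {R : Type u} [Ring R]

variable (R) in
/-- A sequence of complexes `⋯ ⟶ X₂ ⟶ X₁ ⟶ X₀` with degreewise split transition maps. -/
structure SplitTower where
  obj : ℕ → CochainComplex (ModuleCat.{v} R) ℤ
  map (l : ℕ) : obj (l + 1) ⟶ obj l
  /-- Sections of the transition maps in each degree, not compatible with the differentials. -/
  σ (l : ℕ) (n : ℤ) : (obj l).X n ⟶ (obj (l + 1)).X n
  σ_map (l : ℕ) (n : ℤ) : σ l n ≫ (map l).f n = 𝟙 _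

namespace SplitTower

variable (T : SplitTower.{u, v} R)

/-- The product of the terms of a tower. -/
noncomputable def product : CochainComplex (ModuleCat.{v} R) ℤ where
  X n := ModuleCat.of R (∀ l, (T.obj l).X n)
  d i j := ModuleCat.ofHom (LinearMap.piMap fun l => ((T.obj l).d i j).hom)
  shape i j hij := by
    ext x l
    exact ConcreteCategory.congr_hom ((T.obj l).shape i j hij) _
  d_comp_d' i j k _ _ := by
    ext x l
    exact ConcreteCategory.congr_hom ((T.obj l).d_comp_d i j k) _

/-- The projections of the product. -/
noncomputable def proj (l : ℕ) : T.product ⟶ T.obj l where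
  f n := ModuleCat.ofHom (LinearMap.proj l)

theorem product_hom_ext {n : ℤ} {A : ModuleCat.{v} R} {f g : A ⟶ T.product.X n}
    (h : ∀ l, f ≫ (T.proj l).f n = g ≫ (T.proj l).f n) : f = g := by
  ext x
  funext l
  exact ConcreteCategory.congr_hom (h l) x

/-- Maps into a term of the product. -/
noncomputable def lift {n : ℤ} {A : ModuleCat.{v} R} (f : ∀ l, A ⟶ (T.obj l).X n) :
    A ⟶ T.product.X n :=
  ModuleCat.ofHom (LinearMap.pi fun l => (f l).hom)

theorem lift_proj {n : ℤ} {A : ModuleCat.{v} R} (f : ∀ l, A ⟶ (T.obj l).X n) (l : ℕ) :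
    T.lift f ≫ (T.proj l).f n = f l := rfl

/-- The endomorphism `(x_l) ↦ (image of x_{l+1})` of the product. -/
noncomputable def shift : T.product ⟶ T.product where
  f n := ModuleCat.ofHom (LinearMap.pi fun l => ((T.map l).f n).hom ∘ₗ LinearMap.proj (l + 1))
  comm' i j _ := by
    ext x
    funext l
    exact ConcreteCategory.congr_hom ((T.map l).comm i j) _

theorem shift_proj (l : ℕ) : T.shift ≫ T.proj l = T.proj (l + 1) ≫ T.map l := rfl

/-- The components of a section of `𝟙 - T.shift`. -/
noncomputable def shiftSection (n : ℤ) : ∀ l, T.product.X n ⟶ (T.obj l).X n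
  | 0 => 0
  | l + 1 => (shiftSection n l - (T.proj l).f n) ≫ T.σ l n

theorem comp_one_sub_shift_proj {n : ℤ} {A : ModuleCat.{v} R} (f : A ⟶ T.product.X n) (l : ℕ) :
    (f ≫ (𝟙 T.product - T.shift).f n) ≫ (T.proj l).f n =
      f ≫ (T.proj l).f n - (f ≫ (T.proj (l + 1)).f n) ≫ (T.map l).f n := by
  rw [Category.assoc, ← HomologicalComplex.comp_f, Preadditive.sub_comp, T.shift_proj,
    Category.id_comp, HomologicalComplex.sub_f_apply, HomologicalComplex.comp_f,
    Preadditive.comp_sub, Category.assoc]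

theorem lift_shiftSection (n : ℤ) :
    T.lift (T.shiftSection n) ≫ (𝟙 T.product - T.shift).f n = 𝟙 _ :=
  T.product_hom_ext fun l => by
    rw [comp_one_sub_shift_proj, lift_proj, lift_proj, shiftSection, Category.assoc, T.σ_map,
      Category.comp_id, sub_sub_cancel, Category.id_comp]

/-- The limit of a tower, as the complex of fixed points of the shift. -/
noncomputable def limit : CochainComplex (ModuleCat.{v} R) ℤ :=
  Limits.kernel (𝟙 T.product - T.shift)

/-- The projections of the limit onto the terms of the tower. -/
noncomputable def limitProj (l : ℕ) : T.limit ⟶ T.obj l := Limits.kernel.ι _ ≫ T.proj l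

theorem limitProj_map (l : ℕ) : T.limitProj (l + 1) ≫ T.map l = T.limitProj l := by
  have h := Limits.kernel.condition (𝟙 T.product - T.shift)
  rw [Preadditive.comp_sub, Category.comp_id, sub_eq_zero] at h
  exact (congrArg (· ≫ T.proj l) h).symm

theorem limit_hom_ext {n : ℤ} {A : ModuleCat.{v} R} {f g : A ⟶ T.limit.X n}
    (h : ∀ l, f ≫ (T.limitProj l).f n = g ≫ (T.limitProj l).f n) : f = g :=
  (cancel_mono ((Limits.kernel.ι (𝟙 T.product - T.shift)).f n)).1 (T.product_hom_ext h)

theorem exists_limitLift {n : ℤ} {A : ModuleCat.{v} R} (x : ∀ l, A ⟶ (T.obj l).X n)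
    (hx : ∀ l, x (l + 1) ≫ (T.map l).f n = x l) :
    ∃ y : A ⟶ T.limit.X n, ∀ l, y ≫ (T.limitProj l).f n = x l := by
  refine ⟨kernelLift _ (T.lift x) (T.product_hom_ext fun l => ?_), fun l => ?_⟩
  · rw [comp_one_sub_shift_proj, lift_proj, lift_proj, hx, sub_self, Limits.zero_comp]
  · exact (congrArg (· ≫ (T.proj l).f n) (kernelLift_ι _ _ _)).trans (T.lift_proj x l)

/-- The components of a section of the projection of the limit onto the first term. -/
noncomputable def iterateSection (n : ℤ) : ∀ l, (T.obj 0).X n ⟶ (T.obj l).X n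
  | 0 => 𝟙 _
  | l + 1 => iterateSection n l ≫ T.σ l n

theorem exists_limitProj_zero_section (n : ℤ) :
    ∃ s : (T.obj 0).X n ⟶ T.limit.X n, s ≫ (T.limitProj 0).f n = 𝟙 _ :=
  let ⟨s, hs⟩ := T.exists_limitLift (T.iterateSection n) fun l => by
    rw [iterateSection, Category.assoc, T.σ_map, Category.comp_id]
  ⟨s, hs 0⟩

/-- The part of the limit lying over zero in the first term of the tower. -/
noncomputable def fiber : CochainComplex (ModuleCat.{v} R) ℤ := Limits.kernel (T.limitProj 0)

/-- The projections of the fiber onto the terms of the tower. -/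
noncomputable def fiberProj (l : ℕ) : T.fiber ⟶ T.obj l :=
  Limits.kernel.ι (T.limitProj 0) ≫ T.limitProj l

theorem fiberProj_zero : T.fiberProj 0 = 0 := Limits.kernel.condition (T.limitProj 0)

theorem fiberProj_map (l : ℕ) : T.fiberProj (l + 1) ≫ T.map l = T.fiberProj l :=
  congrArg (Limits.kernel.ι (T.limitProj 0) ≫ ·) (T.limitProj_map l)

theorem fiber_hom_ext {n : ℤ} {A : ModuleCat.{v} R} {f g : A ⟶ T.fiber.X n}
    (h : ∀ l, f ≫ (T.fiberProj l).f n = g ≫ (T.fiberProj l).f n) : f = g :=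
  (cancel_mono ((Limits.kernel.ι (T.limitProj 0)).f n)).1 (T.limit_hom_ext h)

theorem exists_fiberLift {n : ℤ} {A : ModuleCat.{v} R} (x : ∀ l, A ⟶ (T.obj l).X n)
    (h_zero : x 0 = 0) (h_succ : ∀ l, x (l + 1) ≫ (T.map l).f n = x l) :
    ∃ y : A ⟶ T.fiber.X n, ∀ l, y ≫ (T.fiberProj l).f n = x l := by
  obtain ⟨y, hy⟩ := T.exists_limitLift x h_succ
  exact ⟨kernelLift _ y ((hy 0).trans h_zero), fun l =>
    (congrArg (· ≫ (T.limitProj l).f n) (kernelLift_ι _ _ _)).trans (hy l)⟩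

theorem limit_isPureExact (hT : ∀ (M : Type (max u v)) [AddCommGroup M] [Module Rᵐᵒᵖ M] (n : ℤ),
    HomologicalComplex.homologyMap
      (((tensorFunctor R M).mapHomologicalComplex _).map T.shift) n = 0) :
    IsPureExact T.limit := by
  refine isPureExact_iff_acyclic.2 fun M _ _ => ?_
  let F := (tensorFunctor R M).mapHomologicalComplex (.up ℤ)
  have hS : ((ShortComplex.kernelSequence (𝟙 T.product - T.shift)).map F).ShortExact :=
    HomologicalComplex.shortExact_of_degreewise_shortExact _ fun n =>
      ((kernelSplitting _ _ (T.lift_shiftSection n)).map (tensorFunctor R M)).shortExact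
  refine hS.acyclic_X₁ ((quasiIso_iff _).2 fun n => ?_)
  rw [quasiIsoAt_iff_isIso_homologyMap]
  have : HomologicalComplex.homologyMap (F.map (𝟙 T.product - T.shift)) n = 𝟙 _ := by
    rw [F.map_sub, F.map_id, HomologicalComplex.homologyMap_sub, hT,
      HomologicalComplex.homologyMap_id, sub_zero]
  rw [ShortComplex.map_g]
  exact this ▸ inferInstanceAs (IsIso (𝟙 _))

end SplitTower
end Tower

/-! ### The Adams tower -/

section AdamsTower

variable {R : Type u} [Ring R]

/-- The double character modules of the cokernels of the differentials of a complex. -/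
noncomputable def cokernelBidual (C : CochainComplex (ModuleCat.{v} R) ℤ) :
    CochainComplex (ModuleCat.{v} R) ℤ where
  X n := ModuleCat.of R (CharacterModule (CharacterModule
    (C.X n ⧸ LinearMap.range (C.d (n - 1) n).hom)))
  d _ _ := 0

/-- The canonical map to `cokernelBidual C`, whose differential is zero. -/
noncomputable def toCokernelBidual (C : CochainComplex (ModuleCat.{v} R) ℤ) :
    C ⟶ cokernelBidual C where
  f n := ModuleCat.ofHom (toBidual R _ ∘ₗ (LinearMap.range (C.d (n - 1) n).hom).mkQ)
  comm' i j hij := by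
    obtain rfl : i = j - 1 := eq_sub_of_add_eq hij
    ext x
    have hx : (LinearMap.range (C.d (j - 1) j).hom).mkQ (C.d (j - 1) j x) = 0 :=
      (Submodule.Quotient.mk_eq_zero _).2 ⟨x, rfl⟩
    exact ((congrArg (toBidual R _) hx).trans (map_zero _)).symm

theorem exact_piMap {ι : Type*} {A B C : ι → Type*} [∀ l, AddCommGroup (A l)]
    [∀ l, Module R (A l)] [∀ l, AddCommGroup (B l)] [∀ l, Module R (B l)]
    [∀ l, AddCommGroup (C l)] [∀ l, Module R (C l)] {f : ∀ l, A l →ₗ[R] B l}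
    {g : ∀ l, B l →ₗ[R] C l} (h : ∀ l, Function.Exact (f l) (g l)) :
    Function.Exact (LinearMap.piMap f) (LinearMap.piMap g) := fun x =>
  calc LinearMap.piMap g x = 0
    _ ↔ ∀ l, ∃ y, f l y = x l := funext_iff.trans (forall_congr' fun l => h l (x l))
    _ ↔ ∃ y : ∀ l, A l, ∀ l, f l (y l) = x l := Classical.skolem
    _ ↔ ∃ y, LinearMap.piMap f y = x := exists_congr fun _ => funext_iff.symm

theorem balancedMap_piMap_toCokernelBidual_exact {ι : Type*}
    (C : ι → CochainComplex (ModuleCat.{v} R) ℤ) (M : Type*) [AddCommGroup M] [Module Rᵐᵒᵖ M]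
    (n : ℤ) :
    Function.Exact (balancedMap M (LinearMap.piMap fun l => ((C l).d (n - 1) n).hom))
      (balancedMap M (LinearMap.piMap fun l => ((toCokernelBidual (C l)).f n).hom)) := by
  have hq := balancedMap_exact (M := M)
    (exact_piMap fun l => LinearMap.exact_map_mkQ_range ((C l).d (n - 1) n).hom)
    (Function.Surjective.piMap fun l => Submodule.mkQ_surjective _)
  have hj : ReflectsLinearSystems (LinearMap.piMap fun l =>
    toBidual R ((C l).X n ⧸ LinearMap.range ((C l).d (n - 1) n).hom)) :=
    .pi fun l => reflectsLinearSystems_toBidual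
  have := hq.comp_injective _ hj.balancedMap_injective (map_zero _)
  rwa [← LinearMap.coe_comp, ← balancedMap_comp] at this

section MappingCocone

open CochainComplex.mappingCocone

variable {C : Type*} [Category* C] [Preadditive C] {K L : CochainComplex C ℤ} (φ : K ⟶ L)
  [HomologicalComplex.HasHomotopyCofiber φ]

theorem mappingCocone_hom_ext {m n : ℤ} (hmn : n + -1 = m) {A : C}
    {f g : A ⟶ (CochainComplex.mappingCocone φ).X n} (hfst : f ≫ (fst φ).f n = g ≫ (fst φ).f n)
    (hsnd : f ≫ (snd φ).v n m hmn = g ≫ (snd φ).v n m hmn) : f = g := by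
  rw [← Category.comp_id f, ← Category.comp_id g, ← id_X φ n m hmn, Preadditive.comp_add,
    Preadditive.comp_add, reassoc_of% hfst, reassoc_of% hsnd]

theorem mappingCocone_exists_lift {m n : ℤ} (hmn : n + -1 = m) {A : C} (f : A ⟶ K.X n)
    (g : A ⟶ L.X m) : ∃ y : A ⟶ (CochainComplex.mappingCocone φ).X n,
      y ≫ (fst φ).f n = f ∧ y ≫ (snd φ).v n m hmn = g :=
  ⟨f ≫ (inl φ).v n n (add_zero n) + g ≫ (inr φ).1.v m n (by omega), by simp, by simp⟩

theorem d_comp_mappingCocone_snd (hL : ∀ i j, L.d i j = 0) (m n : ℤ) (hmn : n + -1 = m) :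
    (CochainComplex.mappingCocone φ).d m n ≫ (snd φ).v n m hmn = -((fst φ).f m ≫ φ.f m) := by
  have hsnd : snd φ = descCochain φ 0 (.ofHom (𝟙 L)) (neg_add_cancel 1) := by
    ext p q hpq
    refine (cancel_epi (𝟙 _)).1 ?_
    rw [← id_X φ p q hpq]
    simp
  have h := CochainComplex.HomComplex.Cochain.congr_v
    (δ_descCochain φ 0 (.ofHom (𝟙 L)) (neg_add_cancel 1) 1 (zero_add 1)) m m (add_zero m)
  rw [← hsnd, CochainComplex.HomComplex.δ_v (-1) 0 (neg_add_cancel 1) _ _ _ _ (m - 1) n rfl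
    (by omega)] at h
  simpa [hL] using h

end MappingCocone

/-- The terms of `adamsTower X`. -/
noncomputable def adamsTerm (X : CochainComplex (ModuleCat.{v} R) ℤ) :
    ℕ → CochainComplex (ModuleCat.{v} R) ℤ
  | 0 => X
  | l + 1 => CochainComplex.mappingCocone (toCokernelBidual (adamsTerm X l))

/-- The tower over `X` in which each term is the mapping cocone of the canonical map from the
previous one to its `cokernelBidual`. -/
noncomputable def adamsTower (X : CochainComplex (ModuleCat.{v} R) ℤ) : SplitTower.{u, v} R where
  obj := adamsTerm X
  map _ := CochainComplex.mappingCocone.fst _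
  σ l n := (CochainComplex.mappingCocone.inl (toCokernelBidual (adamsTerm X l))).v n n (add_zero n)
  σ_map _ n := CochainComplex.mappingCocone.inl_v_fst_f _ n

variable (X : CochainComplex (ModuleCat.{v} R) ℤ)

/-- The projection of a term of the tower onto the module by which it extends the previous one. -/
noncomputable def adamsTower.snd (l : ℕ) (n : ℤ) : ((adamsTower X).obj (l + 1)).X (n + 1) ⟶
    (cokernelBidual ((adamsTower X).obj l)).X n :=
  (CochainComplex.mappingCocone.snd (toCokernelBidual (adamsTerm X l))).v (n + 1) n (by omega)

theorem adamsTower.d_snd (l : ℕ) (n : ℤ) : ((adamsTower X).obj (l + 1)).d n (n + 1) ≫ snd X l n =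
    -(((adamsTower X).map l).f n ≫ (toCokernelBidual ((adamsTower X).obj l)).f n) :=
  d_comp_mappingCocone_snd _ (fun _ _ => rfl) _ _ _

theorem homologyMap_adamsTower_shift (M : Type*) [AddCommGroup M] [Module Rᵐᵒᵖ M] (n : ℤ) :
    HomologicalComplex.homologyMap (((tensorFunctor R M).mapHomologicalComplex _).map
      (adamsTower X).shift) n = 0 := by
  let T := adamsTower X
  refine homologyMap_eq_zero _ (i := n - 1) (k := n + 1) fun z hz =>
    (balancedMap_piMap_toCokernelBidual_exact T.obj M n _).1 ?_
  let g : T.product.X n ⟶ ModuleCat.of R (∀ l, (cokernelBidual (T.obj l)).X n) :=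
    ModuleCat.ofHom (LinearMap.piMap fun l => ((toCokernelBidual (T.obj l)).f n).hom)
  let s : T.product.X (n + 1) ⟶ ModuleCat.of R (∀ l, (cokernelBidual (T.obj l)).X n) :=
    ModuleCat.ofHom (-LinearMap.pi fun l =>
      (adamsTower.snd X l n).hom ∘ₗ LinearMap.proj (l + 1))
  have hgs : T.shift.f n ≫ g = T.product.d n (n + 1) ≫ s := by
    ext x l
    exact neg_eq_iff_eq_neg.1
      (ConcreteCategory.congr_hom (adamsTower.d_snd X l n) (x (l + 1))).symm
  have hz' := ConcreteCategory.congr_hom (congrArg (tensorFunctor R M).map hgs) z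
  rw [Functor.map_comp, Functor.map_comp] at hz'
  exact hz'.trans ((congrArg ((tensorFunctor R M).map s) hz).trans (map_zero _))

theorem adamsTower.hom_ext {l : ℕ} {n : ℤ} {A : ModuleCat.{v} R}
    {f g : A ⟶ ((adamsTower X).obj (l + 1)).X (n + 1)}
    (hmap : f ≫ ((adamsTower X).map l).f (n + 1) = g ≫ ((adamsTower X).map l).f (n + 1))
    (hsnd : f ≫ snd X l n = g ≫ snd X l n) : f = g :=
  mappingCocone_hom_ext _ _ hmap hsnd

theorem adamsTower.exists_lift {l : ℕ} {n : ℤ} {A : ModuleCat.{v} R}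
    (f : A ⟶ ((adamsTower X).obj l).X (n + 1))
    (k : A ⟶ (cokernelBidual ((adamsTower X).obj l)).X n) :
    ∃ y : A ⟶ ((adamsTower X).obj (l + 1)).X (n + 1),
      y ≫ ((adamsTower X).map l).f (n + 1) = f ∧ y ≫ snd X l n = k :=
  mappingCocone_exists_lift _ _ f k

/-- The projections of the fiber onto the modules by which the tower is extended. -/
noncomputable def adamsTower.fiberπ (l : ℕ) (n : ℤ) : (adamsTower X).fiber.X (n + 1) ⟶
    (cokernelBidual ((adamsTower X).obj l)).X n :=
  ((adamsTower X).fiberProj (l + 1)).f (n + 1) ≫ snd X l n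

theorem adamsTower.comp_fiberProj_eq {n : ℤ} {A : ModuleCat.{v} R}
    {f g : A ⟶ (adamsTower X).fiber.X (n + 1)} :
    ∀ l : ℕ, (∀ j < l, f ≫ fiberπ X j n = g ≫ fiberπ X j n) →
      f ≫ ((adamsTower X).fiberProj l).f (n + 1) = g ≫ ((adamsTower X).fiberProj l).f (n + 1)
  | 0, _ => by
    rw [(adamsTower X).fiberProj_zero, HomologicalComplex.zero_f, Limits.comp_zero,
      Limits.comp_zero]
  | l + 1, h => by
    refine hom_ext X ?_ ?_
    · rw [Category.assoc, Category.assoc, ← HomologicalComplex.comp_f,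
        (adamsTower X).fiberProj_map]
      exact comp_fiberProj_eq l fun j hj => h j (hj.trans l.lt_succ_self)
    · rw [Category.assoc, Category.assoc]
      exact h l l.lt_succ_self

theorem adamsTower.comp_d_fiberπ {l : ℕ} {n : ℤ} {A : ModuleCat.{v} R}
    {f : A ⟶ (adamsTower X).fiber.X n} (hf : f ≫ ((adamsTower X).fiberProj l).f n = 0) :
    (f ≫ (adamsTower X).fiber.d n (n + 1)) ≫ fiberπ X l n = 0 := by
  rw [fiberπ, Category.assoc, ← HomologicalComplex.Hom.comm_assoc, d_snd, Preadditive.comp_neg,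
    ← Category.assoc _ _ (HomologicalComplex.Hom.f _ n), ← HomologicalComplex.comp_f,
    (adamsTower X).fiberProj_map, Preadditive.comp_neg, reassoc_of% hf, Limits.zero_comp, neg_zero]

theorem adamsTower.exists_fiberπ_eq {n : ℤ} {A : ModuleCat.{v} R}
    (k : ∀ l, A ⟶ (cokernelBidual ((adamsTower X).obj l)).X n) :
    ∃ y : A ⟶ (adamsTower X).fiber.X (n + 1), ∀ l, y ≫ fiberπ X l n = k l := by
  choose y hy_map hy_snd using fun l f => exists_lift X (A := A) (n := n) (l := l) f (k l)
  let x : ∀ l, A ⟶ ((adamsTower X).obj l).X (n + 1) := Nat.rec 0 y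
  obtain ⟨z, hz⟩ := (adamsTower X).exists_fiberLift x rfl fun l => hy_map l (x l)
  exact ⟨z, fun l => by rw [fiberπ, reassoc_of% hz]; exact hy_snd l (x l)⟩

/-- The shifted fiber is degreewise the product of the modules by which the tower is extended. -/
noncomputable def adamsTower.fiberTriangularProduct :
    TriangularProduct ((adamsTower X).fiber⟦(1 : ℤ)⟧) where
  layer l n := (cokernelBidual ((adamsTower X).obj l)).X n
  π l n := fiberπ X l n
  isLimit n := Limits.Fan.IsLimit.mk _ (fun s => (exists_fiberπ_eq X s.proj).choose)
    (fun s => (exists_fiberπ_eq X s.proj).choose_spec) fun s m hm =>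
      (adamsTower X).fiber_hom_ext fun l => comp_fiberProj_eq X l fun j _ =>
        (hm j).trans ((exists_fiberπ_eq X s.proj).choose_spec j).symm
  triangular l m n A g hg := by
    by_cases hmn : m + 1 = n
    · subst hmn
      have h := comp_d_fiberπ X ((comp_fiberProj_eq X (f := g) (g := 0) l fun j hj =>
        (hg j hj).trans Limits.zero_comp.symm).trans Limits.zero_comp)
      have hd : g ≫ ((adamsTower X).fiber⟦(1 : ℤ)⟧).d m (m + 1) =
          -(g ≫ (adamsTower X).fiber.d (m + 1) (m + 1 + 1)) := by
        rw [CochainComplex.shiftFunctor_obj_d', Int.negOnePow_one, Units.neg_smul, one_smul]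
        exact Preadditive.comp_neg _ _
      exact (congrArg (· ≫ fiberπ X l (m + 1)) hd).trans
        ((Preadditive.neg_comp _ _).trans (neg_eq_zero.2 h))
    · rw [HomologicalComplex.shape _ _ _ hmn, Limits.comp_zero]
      exact Limits.zero_comp

end AdamsTower

section Resolution

variable {R : Type u} [Ring R] (X : CochainComplex (ModuleCat.{v} R) ℤ)

/-- The short exact sequence `fiber ⟶ limit ⟶ X` of the tower over `X`. -/
noncomputable abbrev adamsTower.fiberSequence :
    ShortComplex (CochainComplex (ModuleCat.{v} R) ℤ) :=
  .kernelSequence ((adamsTower X).limitProj 0)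

/-- The degreewise splitting of the fiber sequence. -/
noncomputable def adamsTower.fiberSplitting (n : ℤ) :
    ((fiberSequence X).map (HomologicalComplex.eval _ _ n)).Splitting :=
  kernelSplitting _ _ ((adamsTower X).exists_limitProj_zero_section n).choose_spec

/-- The pure injective resolution of `X`: the connecting map of the fiber sequence. -/
noncomputable def adamsTower.resolution : X ⟶ (adamsTower X).fiber⟦(1 : ℤ)⟧ :=
  CochainComplex.homOfDegreewiseSplit (fiberSequence X) (fiberSplitting X)

theorem adamsTower.isPureQuasiIso_resolution : IsPureQuasiIso (resolution X) :=
  ((adamsTower X).limit_isPureExact fun M _ _ n => homologyMap_adamsTower_shift X M n).shift 1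
    |>.of_iso (CochainComplex.mappingConeHomOfDegreewiseSplitIso _ (fiberSplitting X)).symm

theorem adamsTower.isPureInjectiveResolution_resolution :
    IsPureInjectiveResolution (resolution X) where
  quasiIso := isPureQuasiIso_resolution X
  pureInjective n := isPureInjective_of_isLimit_fan ((fiberTriangularProduct X).isLimit n)
    fun _ => (hasAdditiveExtensions_character _).isPureInjective
  hom_pureExact _ hE := (fiberTriangularProduct X).homComplex_isPureExact
    (fun _ _ => hasAdditiveExtensions_character _) hE

end Resolution

end PureHomology

theorem theorem5p2_general {R : Type u} [Ring R] (X : CochainComplex (ModuleCat.{v} R) ℤ) :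
    ∃ (I : CochainComplex (ModuleCat.{v} R) ℤ) (f : X ⟶ I),
      PureHomology.IsPureInjectiveResolution f :=
  ⟨_, _, PureHomology.adamsTower.isPureInjectiveResolution_resolution X⟩

theorem theorem5p2 {R : Type u} [Ring R] (X : CochainComplex (ModuleCat.{u} R) ℤ)
    (hX : ∃ b : ℤ, ∀ i : ℤ, b < i → Limits.IsZero (X.X i)) :
    ∃ (I : CochainComplex (ModuleCat.{u} R) ℤ) (f : X ⟶ I),
      PureHomology.IsPureInjectiveResolution f :=
  theorem5p2_general X
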